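/- **Notation.** For a contraction $T\in\mathbf L(\mathfrak M,\mathfrak N)$ between complex Hilbert spaces put $D_T=(I-T^*T)^{1/2}$ and $\mathfrak D_T=\overline{\operatorname{ran}}\,D_T$. Let $\mathbb D$ be the open unit disk. The Schur class $\mathbf S(\mathfrak M,\mathfrak N)$ consists of the holomorphic functions $\Theta$ on $\mathbb D$ with values in $\mathbf L(\mathfrak M,\mathfrak N)$ and $\|\Theta(\lambda)\|\le 1$. The Möbius parameter of $\Theta\in\mathbf S(\mathfrak M,\mathfrak N)$ is the function $Z\in\mathbf S(\mathfrak D_{\Theta(0)},\mathfrak D_{\Theta(0)^*})$ such that, for all $\lambda\in\mathbb D$, $I+\Theta(0)^*Z(\lambda)$ is boundedly invertible on $\mathfrak D_{\Theta(0)}$ and $$\Theta(\lambda)=\Theta(0)+D_{\Theta(0)^*}Z(\lambda)\bigl(I+\Theta(0)^*Z(\lambda)\bigr)^{-1}D_{\Theta(0)} .$$ A contraction $A$ in $\mathfrak H$ is completely non-unitary if no nonzero closed subspace reduces $A$ to a unitary operator. The characteristic function of a contraction $A$ is $$\Phi_A(\lambda)=\bigl(-A+\lambda D_{A^*}(I-\lambda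 A^*)^{-1}D_A\bigr)\restriction\mathfrak D_A:\ \mathfrak D_A\to\mathfrak D_{A^*},\qquad \lambda\in\mathbb D .$$ A unilateral shift is an isometry $S$ of a Hilbert space $\mathcal K$ such that $\mathcal K=\bigoplus_{n\ge0}S^n\Omega$ (orthogonal sum) for some closed subspace $\Omega$; a co-shift is an operator whose adjoint is a unilateral shift. (The operator on $\{0\}$ counts as both.) With $P_{\mathcal L}$ the orthogonal projection onto $\mathcal L$, put $$A_{1,0}=P_{\ker D_A}A\restriction\ker D_A,\qquad A_{0,1}=P_{\ker D_{A^*}}A\restriction\ker D_{A^*},\qquad \mathcal A=AP_{\ker D_A}\in\mathbf L(\mathfrak H).$$ **Theorem.** Let $A$ be a completely non-unitary contraction in a complex Hilbert space $\mathfrak H$. Then $\mathcal A$ is a partial isometry with $\mathfrak D_{\mathcal A}=\mathfrak D_A$ and $\mathfrak D_{\mathcal A^*}=\mathfrak D_{A^*}$, the operators $A_{1,0}$ and $A_{0,1}$ are unitarily equivalent, $\mathfrak D_{\Phi_A(0)}=\mathfrak D_A$ and $\mathfrak D_{\Phi_A(0)^*}=\mathfrak D_{A^*}$, the Möbius parameter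 $Z$ of $\Phi_A$ exists, and $Z(\lambda)=\Phi_{\mathcal A}(\lambda)$ for all $\lambda\in\mathbb D$. Moreover: (a) the following are equivalent: $A_{1,0}$ is a unilateral shift; $A_{0,1}$ is a unilateral shift; $\mathfrak D_A\subset\mathfrak D_{A^*}$; $Z(\lambda)f=\lambda f$ for all $\lambda\in\mathbb D$ and $f\in\mathfrak D_A$ (that is, $Z(\lambda)=\lambda I_{\mathfrak D_A}$); (b) the following are equivalent: $A_{1,0}$ is a co-shift; $A_{0,1}$ is a co-shift; $\mathfrak D_{A^*}\subset\mathfrak D_A$; $Z(\bar\lambda)^*g=\lambda g$ for all $\lambda\in\mathbb D$ and $g\in\mathfrak D_{A^*}$ (that is, $Z^*(\bar\lambda)=\lambda I_{\mathfrak D_{A^*}}$). -/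

import Mathlib

noncomputable section

namespace CNU

section Defect

variable {E F : Type*}
  [NormedAddCommGroup E] [InnerProductSpace ℂ E] [CompleteSpace E]
  [NormedAddCommGroup F] [InnerProductSpace ℂ F] [CompleteSpace F]

/-- The defect operator `D_T = (I - T* T)^{1/2}` of a contraction `T`
(the positive square root, by the continuous functional calculus). -/
def defectOp (T : E →L[ℂ] F) : E →L[ℂ] E :=
  CFC.sqrt (1 - T.adjoint ∘L T)

/-- The defect subspace `𝔇_T`, the closure of the range of `D_T`.
The space `𝔇_{T*}` is `defectSpace T.adjoint`. -/
abbrev defectSpace (T : E →L[ℂ] F) : Submodule ℂ E :=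
  (defectOp T).range.topologicalClosure

/-- The subspace `ker D_T`. -/
abbrev defectKer (T : E →L[ℂ] F) : Submodule ℂ E :=
  (defectOp T).ker

/-- `D_T` as an operator from the whole space into `𝔇_T`. -/
def defectOpTo (T : E →L[ℂ] F) : E →L[ℂ] defectSpace T :=
  (defectOp T).codRestrict (defectSpace T)
    (fun x => Submodule.le_topologicalClosure _ ⟨x, rfl⟩)

/-- An operator `T : E → F` seen between two closed subspaces: `P_L T ↾ K`.
If `T` maps `K` into `L`, this is the plain restriction of `T`. -/
def between (K : Submodule ℂ E) (L : Submodule ℂ F) [L.HasOrthogonalProjection]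
    (T : E →L[ℂ] F) : K →L[ℂ] L :=
  L.orthogonalProjectionOnto ∘L T ∘L K.subtypeL

theorem coe_between_of_mem (K : Submodule ℂ E) (L : Submodule ℂ F) [L.HasOrthogonalProjection]
    (T : E →L[ℂ] F) (x : K) (hx : T x ∈ L) : (between K L T x : F) = T x :=
  Submodule.starProjection_eq_self_iff.mpr hx

theorem one_sub_nonneg {T : E →L[ℂ] F} (hT : ‖T‖ ≤ 1) :
    0 ≤ 1 - T.adjoint ∘L T := by
  rw [ContinuousLinearMap.nonneg_iff_isPositive, ContinuousLinearMap.isPositive_iff_complex]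
  intro x
  have h1 : ‖T x‖ ≤ ‖x‖ := T.le_of_opNorm_le_of_le hT le_rfl |>.trans (by simp)
  have h2 : inner ℂ ((1 - T.adjoint ∘L T) x) x = ((‖x‖ ^ 2 - ‖T x‖ ^ 2 : ℝ) : ℂ) := by
    simp [ContinuousLinearMap.adjoint_inner_left, inner_self_eq_norm_sq_to_K]
  rw [h2]
  refine ⟨by simp [← Complex.ofReal_pow], ?_⟩
  have : ‖T x‖ ^ 2 ≤ ‖x‖ ^ 2 := by gcongr
  simp only [RCLike.re_to_complex, Complex.ofReal_re]
  linarith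

/-- `D_T² = I - T* T` for a contraction `T`. -/
theorem defectOp_mul_self {T : E →L[ℂ] F} (hT : ‖T‖ ≤ 1) :
    defectOp T * defectOp T = 1 - T.adjoint ∘L T :=
  CFC.sqrt_mul_sqrt_self _ (one_sub_nonneg hT)

theorem defectOp_isSelfAdjoint (T : E →L[ℂ] F) : IsSelfAdjoint (defectOp T) :=
  (CFC.sqrt_nonneg _).isSelfAdjoint

/-- For a contraction, `D_T f = 0` if and only if `T* T f = f`. -/
theorem mem_defectKer_iff {T : E →L[ℂ] F} (hT : ‖T‖ ≤ 1) (f : E) :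
    f ∈ defectKer T ↔ T.adjoint (T f) = f := by
  have h2 : defectOp T (defectOp T f) = f - T.adjoint (T f) := by
    simpa using congrArg (fun S : E →L[ℂ] E => S f) (defectOp_mul_self hT)
  constructor
  · intro h
    have h' : defectOp T f = 0 := h
    rw [h', map_zero] at h2
    exact (sub_eq_zero.mp h2.symm).symm
  · intro h
    rw [h, sub_self] at h2
    have hsym : (defectOp T).adjoint = defectOp T :=
      ContinuousLinearMap.isSelfAdjoint_iff'.mp (defectOp_isSelfAdjoint T)
    have h3 : inner ℂ (defectOp T f) (defectOp T f) = 0 := by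
      rw [← ContinuousLinearMap.adjoint_inner_left, hsym, h2, inner_zero_left]
    exact inner_self_eq_zero.mp h3

theorem orthogonal_defectKer (T : E →L[ℂ] F) : (defectKer T)ᗮ = defectSpace T := by
  have hsym : (defectOp T).adjoint = defectOp T :=
    ContinuousLinearMap.isSelfAdjoint_iff'.mp (defectOp_isSelfAdjoint T)
  have h := ContinuousLinearMap.orthogonal_ker (defectOp T)
  rwa [hsym] at h

/-- A contraction `T` maps `𝔇_T` into `𝔇_{T*}`. -/
theorem map_mem_defectSpace {T : E →L[ℂ] F} (hT : ‖T‖ ≤ 1) {f : E} (hf : f ∈ defectSpace T) :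
    T f ∈ defectSpace T.adjoint := by
  have hT' : ‖T.adjoint‖ ≤ 1 := by simpa using hT
  rw [← orthogonal_defectKer, Submodule.mem_orthogonal] at hf ⊢
  intro g hg
  rw [mem_defectKer_iff hT', ContinuousLinearMap.adjoint_adjoint] at hg
  rw [← ContinuousLinearMap.adjoint_inner_left]
  refine hf _ ?_
  rw [mem_defectKer_iff hT, hg]

end Defect

section Schur

variable {M N : Type*}
  [NormedAddCommGroup M] [InnerProductSpace ℂ M] [CompleteSpace M]
  [NormedAddCommGroup N] [InnerProductSpace ℂ N] [CompleteSpace N]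

/-- The Schur class `S(M, N)`: functions holomorphic on the open unit disk whose values are
contractions from `M` to `N`. Only the values on the disk matter. -/
def IsSchurClass (Θ : ℂ → M →L[ℂ] N) : Prop :=
  DifferentiableOn ℂ Θ (Metric.ball 0 1) ∧ ∀ z ∈ Metric.ball (0 : ℂ) 1, ‖Θ z‖ ≤ 1

/-- `Z` is the Möbius parameter of `Θ`: it belongs to `S(𝔇_{Θ(0)}, 𝔇_{Θ(0)*})`, and for `|z| < 1`
the operator `I + Θ(0)* Z(z)` on `𝔇_{Θ(0)}` is boundedly invertible and
`Θ(z) = Θ(0) + D_{Θ(0)*} Z(z) (I + Θ(0)* Z(z))⁻¹ D_{Θ(0)}`. -/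
def IsMobiusParameter (Θ : ℂ → M →L[ℂ] N)
    (Z : ℂ → defectSpace (Θ 0) →L[ℂ] defectSpace (Θ 0).adjoint) : Prop :=
  IsSchurClass Z ∧
  ∀ z ∈ Metric.ball (0 : ℂ) 1,
    let R : defectSpace (Θ 0) →L[ℂ] defectSpace (Θ 0) :=
      1 + between (defectSpace (Θ 0).adjoint) (defectSpace (Θ 0)) (Θ 0).adjoint ∘L Z z
    IsUnit R ∧
    Θ z = Θ 0 + (defectOp (Θ 0).adjoint ∘L (defectSpace (Θ 0).adjoint).subtypeL) ∘L
      Z z ∘L Ring.inverse R ∘L defectOpTo (Θ 0)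

end Schur

section Contraction

variable {H : Type*} [NormedAddCommGroup H] [InnerProductSpace ℂ H] [CompleteSpace H]

/-- No nonzero closed subspace `K` reduces `A` to a unitary operator. -/
def IsCompletelyNonUnitary (A : H →L[ℂ] H) : Prop :=
  ∀ K : Submodule ℂ H, IsClosed (K : Set H) →
    (∀ f ∈ K, A f ∈ K) → (∀ f ∈ K, A.adjoint f ∈ K) →
    (∀ f ∈ K, ‖A f‖ = ‖f‖) → (∀ g ∈ K, ∃ f ∈ K, A f = g) → K = ⊥

/-- The characteristic function `Φ_A(z) = (-A + z D_{A*} (I - z A*)⁻¹ D_A) ↾ 𝔇_A`, with values in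
the operators from `𝔇_A` to `𝔇_{A*}`. -/
def charFun (A : H →L[ℂ] H) (z : ℂ) : defectSpace A →L[ℂ] defectSpace A.adjoint :=
  between (defectSpace A) (defectSpace A.adjoint)
    (-A + z • (defectOp A.adjoint ∘L Ring.inverse (1 - z • A.adjoint) ∘L defectOp A))

/-- For a contraction, the restriction in `charFun` involves no projection. -/
theorem coe_charFun {A : H →L[ℂ] H} (hA : ‖A‖ ≤ 1) (z : ℂ) (f : defectSpace A) :
    (charFun A z f : H) = -A f +
      z • defectOp A.adjoint (Ring.inverse (1 - z • A.adjoint) (defectOp A f)) := by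
  unfold charFun
  rw [coe_between_of_mem]
  · simp
  · refine Submodule.add_mem _ (Submodule.neg_mem _ (map_mem_defectSpace hA f.2)) ?_
    exact Submodule.smul_mem _ _ (Submodule.le_topologicalClosure _ ⟨_, rfl⟩)

/-- `S` is a unilateral shift: an isometry with a wandering (closed) subspace `Ω` such that the
whole space is the orthogonal sum of the subspaces `S^n Ω`, `n ≥ 0`. -/
def IsUnilateralShift (S : H →L[ℂ] H) : Prop :=
  (∀ f, ‖S f‖ = ‖f‖) ∧
  ∃ Ω : Submodule ℂ H, IsClosed (Ω : Set H) ∧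
    (∀ p q : ℕ, p ≠ q → Ω.map ((S ^ p : H →L[ℂ] H) : H →ₗ[ℂ] H) ⟂
      Ω.map ((S ^ q : H →L[ℂ] H) : H →ₗ[ℂ] H)) ∧
    (⨆ n : ℕ, Ω.map ((S ^ n : H →L[ℂ] H) : H →ₗ[ℂ] H)).topologicalClosure = ⊤

/-- A co-shift is an operator whose adjoint is a unilateral shift. -/
def IsCoShift (S : H →L[ℂ] H) : Prop :=
  IsUnilateralShift S.adjoint

/-- Isometric on the orthogonal complement of the kernel. -/
def IsPartialIsometry (V : H →L[ℂ] H) : Prop :=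
  ∀ f ∈ V.kerᗮ, ‖V f‖ = ‖f‖

/-- `A_{1,0} = P_{ker D_A} A ↾ ker D_A`. -/
def opA10 (A : H →L[ℂ] H) : defectKer A →L[ℂ] defectKer A :=
  between (defectKer A) (defectKer A) A

/-- `A_{0,1} = P_{ker D_{A*}} A ↾ ker D_{A*}`. -/
def opA01 (A : H →L[ℂ] H) : defectKer A.adjoint →L[ℂ] defectKer A.adjoint :=
  between (defectKer A.adjoint) (defectKer A.adjoint) A

/-- The operator `A P_{ker D_A}` on the whole space. -/
def isometricPart (A : H →L[ℂ] H) : H →L[ℂ] H :=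
  A ∘L (defectKer A).starProjection

end Contraction

section Equivalence

variable {H₁ H₂ : Type*}
  [NormedAddCommGroup H₁] [InnerProductSpace ℂ H₁] [NormedAddCommGroup H₂] [InnerProductSpace ℂ H₂]

/-- Unitary equivalence of two operators. -/
def UnitarilyEquivalent (S : H₁ →L[ℂ] H₁) (T : H₂ →L[ℂ] H₂) : Prop :=
  ∃ U : H₁ ≃ₗᵢ[ℂ] H₂, ∀ f, U (S f) = T (U f)

end Equivalence

end CNU

end

open ContinuousLinearMap
open scoped ComplexOrder

namespace CNU

/-! ### Defect operators, their kernels and ranges. -/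

section Defect

variable {E F : Type*}
  [NormedAddCommGroup E] [InnerProductSpace ℂ E] [CompleteSpace E]
  [NormedAddCommGroup F] [InnerProductSpace ℂ F] [CompleteSpace F]

/-! Write V = A P_{ker D_A} and L = 𝔇_{A*}. The contraction A maps ker D_A isometrically onto ker
D_{A*}, and 𝔇_A into L. Hence V is a partial isometry whose defect operators are the projections
onto 𝔇_A and L. Since V annihilates 𝔇_A, Φ_V(z) = z P_L (I - zV*)⁻¹ ↾ 𝔇_A
(`coe_charFun_isometricPart`).

The splitting A* = V* + A* P_L (`isometricPart_adjoint_add`) and Φ_A(0)* = -A* ↾ L give, for Z =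
Φ_V, the factorization I + Φ_A(0)* Z(z) = (I - zA*)(I - zV*)⁻¹ ↾ 𝔇_A. Its inverse cancels the
resolvent of V*, and the Möbius formula becomes the definition of Φ_A
(`IsCharFunOf.isMobiusParameter`). The parameter is unique on the disk (`IsMobiusParameter.eqOn`).

If 𝔇_A ⊂ L, then V* vanishes on 𝔇_A and Z(z) = z; conversely, the value at z = 1/2 already puts 𝔇_A
inside L. On the operator side, A_{1,0} is isometric exactly when A(ker D_A) = ker D_{A*} lies in
ker D_A, that is, when 𝔇_A ⊂ L. In that case the intersection of the ranges of its powers reduces A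
to a unitary, so it is zero, and the Wold decomposition gives a shift
(`isUnilateralShift_opA10_iff`). The operator A itself conjugates A_{1,0} to A_{0,1}, and the
co-shift statements are the shift statements for A*. -/

theorem norm_adjoint_le_one {T : E →L[ℂ] F} (hT : ‖T‖ ≤ 1) : ‖T.adjoint‖ ≤ 1 := by
  simpa using hT

omit [CompleteSpace E] [CompleteSpace F] in
theorem norm_apply_le_of_norm_le_one {T : E →L[ℂ] F} (hT : ‖T‖ ≤ 1) (x : E) : ‖T x‖ ≤ ‖x‖ := by
  simpa using T.le_of_opNorm_le hT x

theorem inner_defectOp_left (T : E →L[ℂ] F) (x y : E) :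
    inner ℂ (defectOp T x) y = inner ℂ x (defectOp T y) := by
  rw [← adjoint_inner_left, isSelfAdjoint_iff'.mp (defectOp_isSelfAdjoint T)]

theorem inner_defectOp_nonneg (T : E →L[ℂ] F) (x : E) : 0 ≤ inner ℂ (defectOp T x) x :=
  (nonneg_iff_isPositive _ |>.mp (CFC.sqrt_nonneg _ : 0 ≤ defectOp T)).inner_nonneg_left x

theorem defectOp_defectOp_apply {T : E →L[ℂ] F} (hT : ‖T‖ ≤ 1) (x : E) :
    defectOp T (defectOp T x) = x - T.adjoint (T x) := by
  simpa using congrArg (fun S : E →L[ℂ] E => S x) (defectOp_mul_self hT)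

theorem defectOp_mem_defectSpace (T : E →L[ℂ] F) (x : E) : defectOp T x ∈ defectSpace T :=
  Submodule.le_topologicalClosure _ ⟨x, rfl⟩

theorem defectOp_neg (T : E →L[ℂ] F) : defectOp (-T) = defectOp T := by
  simp [defectOp]

theorem mem_defectSpace_iff (T : E →L[ℂ] F) (x : E) :
    x ∈ defectSpace T ↔ ∀ y ∈ defectKer T, inner ℂ y x = 0 := by
  rw [← orthogonal_defectKer, Submodule.mem_orthogonal]

theorem defectSpace_orthogonal (T : E →L[ℂ] F) : (defectSpace T)ᗮ = defectKer T := by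
  rw [← orthogonal_defectKer, Submodule.orthogonal_orthogonal]

theorem defectKer_le_iff (A B : E →L[ℂ] E) :
    defectKer B ≤ defectKer A ↔ defectSpace A ≤ defectSpace B := by
  rw [← orthogonal_defectKer, ← orthogonal_defectKer, Submodule.orthogonal_le_orthogonal_iff]

theorem eq_zero_of_mem_defectSpace {T : E →L[ℂ] F} {x : E} (hx : x ∈ defectSpace T)
    (h : defectOp T x = 0) : x = 0 :=
  inner_self_eq_zero.mp ((mem_defectSpace_iff T x).mp hx x h)

theorem defectSpace_eq_top {T : E →L[ℂ] F} (h : ∀ x, defectOp T x = 0 → x = 0) :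
    defectSpace T = ⊤ := by
  have hker : defectKer T = ⊥ := (Submodule.eq_bot_iff _).mpr h
  rw [← orthogonal_defectKer, hker, Submodule.bot_orthogonal_eq_top]

/-- A contraction is isometric on the kernel of its defect operator. -/
theorem norm_map_of_mem_defectKer {T : E →L[ℂ] F} (hT : ‖T‖ ≤ 1) {x : E} (hx : x ∈ defectKer T) :
    ‖T x‖ = ‖x‖ := by
  refine le_antisymm (norm_apply_le_of_norm_le_one hT x) ?_
  have h := norm_apply_le_of_norm_le_one (norm_adjoint_le_one hT) (T x)
  rwa [(mem_defectKer_iff hT x).mp hx] at h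

/-- A contraction `T` maps `ker D_T` into `ker D_{T*}`. -/
theorem map_mem_defectKer {T : E →L[ℂ] F} (hT : ‖T‖ ≤ 1) {x : E} (hx : x ∈ defectKer T) :
    T x ∈ defectKer T.adjoint := by
  rw [mem_defectKer_iff (norm_adjoint_le_one hT), adjoint_adjoint, (mem_defectKer_iff hT x).mp hx]

theorem adjoint_map_mem_defectKer {T : E →L[ℂ] F} (hT : ‖T‖ ≤ 1) {y : F}
    (hy : y ∈ defectKer T.adjoint) : T.adjoint y ∈ defectKer T := by
  have h := map_mem_defectKer (norm_adjoint_le_one hT) hy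
  rwa [adjoint_adjoint] at h

theorem adjoint_map_mem_defectSpace {T : E →L[ℂ] F} (hT : ‖T‖ ≤ 1) {y : F}
    (hy : y ∈ defectSpace T.adjoint) : T.adjoint y ∈ defectSpace T := by
  have h := map_mem_defectSpace (norm_adjoint_le_one hT) hy
  rwa [adjoint_adjoint] at h

theorem map_adjoint_of_mem_defectKer {T : E →L[ℂ] F} (hT : ‖T‖ ≤ 1) {y : F}
    (hy : y ∈ defectKer T.adjoint) : T (T.adjoint y) = y := by
  simpa using (mem_defectKer_iff (norm_adjoint_le_one hT) y).mp hy

/-- A contraction intertwines the projections onto `ker D_T` and `ker D_{T*}`. -/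
theorem map_starProjection_defectKer {T : E →L[ℂ] F} (hT : ‖T‖ ≤ 1) (x : E) :
    (defectKer T.adjoint).starProjection (T x) = T ((defectKer T).starProjection x) := by
  apply Submodule.eq_starProjection_of_mem_orthogonal
  · exact map_mem_defectKer hT (Submodule.starProjection_apply_mem _ _)
  · rw [← map_sub, orthogonal_defectKer]
    apply map_mem_defectSpace hT
    rw [← orthogonal_defectKer]
    exact Submodule.sub_starProjection_mem_orthogonal _

theorem adjoint_between (K : Submodule ℂ E) (L : Submodule ℂ F) [CompleteSpace K] [CompleteSpace L]
    (T : E →L[ℂ] F) : (between K L T).adjoint = between L K T.adjoint := by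
  simp only [between, adjoint_comp, Submodule.adjoint_orthogonalProjectionOnto,
    Submodule.adjoint_subtypeL]
  rfl

omit [CompleteSpace E] [CompleteSpace F] in
theorem norm_between_le (K : Submodule ℂ E) (L : Submodule ℂ F) [CompleteSpace L]
    {T : E →L[ℂ] F} (hT : ‖T‖ ≤ 1) : ‖between K L T‖ ≤ 1 := by
  refine opNorm_le_bound _ zero_le_one fun x => ?_
  rw [one_mul]
  exact (L.norm_orthogonalProjectionOnto_apply_le _).trans (norm_apply_le_of_norm_le_one hT _)

omit [CompleteSpace E] [CompleteSpace F] in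
theorem coe_between (K : Submodule ℂ E) (L : Submodule ℂ F) [L.HasOrthogonalProjection]
    (T : E →L[ℂ] F) (x : K) : (between K L T x : F) = L.starProjection (T x) := rfl

/-- The defect operator of the restriction of `T` to `𝔇_T` is the restriction of `D_T`. -/
theorem coe_defectOp_between {T : E →L[ℂ] F} (hT : ‖T‖ ≤ 1) {K : Submodule ℂ E}
    {L : Submodule ℂ F} [CompleteSpace K] [CompleteSpace L] (hK : K = defectSpace T)
    (hL : L = defectSpace T.adjoint) (x : K) :
    (defectOp (between K L T) x : E) = defectOp T x := by
  have hmem : ∀ y : K, defectOp T y ∈ K := fun y => hK ▸ defectOp_mem_defectSpace T y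
  have hmap : ∀ y : K, T y ∈ L := fun y => hL ▸ map_mem_defectSpace hT (hK ▸ y.2)
  have hmap' : ∀ y : L, T.adjoint y ∈ K := fun y => hK ▸ adjoint_map_mem_defectSpace hT (hL ▸ y.2)
  -- The compression of D_T is positive and has the right square, so uniqueness of the positive
  -- square root applies.
  have hD : defectOp (between K L T) = between K K (defectOp T) := by
    refine CFC.sqrt_unique ?_ ?_
    · ext y
      have h1 : ((between L K T.adjoint (between K L T y) : K) : E) = T.adjoint (T y) := by
        rw [coe_between_of_mem _ _ _ _ (hmap' _), coe_between_of_mem _ _ _ _ (hmap _)]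
      simp only [mul_apply_eq_comp, coe_between_of_mem _ _ _ _ (hmem _),
        defectOp_defectOp_apply hT, adjoint_between]
      simp [h1]
    · rw [nonneg_iff_isPositive, isPositive_iff]
      refine ⟨fun y z => ?_, fun y => ?_⟩
      · simp only [coe_coe, Submodule.coe_inner, coe_between_of_mem _ _ _ _ (hmem _)]
        exact inner_defectOp_left _ _ _
      · rw [Submodule.coe_inner, coe_between_of_mem _ _ _ _ (hmem _)]
        exact inner_defectOp_nonneg _ _
  rw [hD, coe_between_of_mem _ _ _ _ (hmem _)]

theorem defectOp_starProjection {T : E →L[ℂ] F} {K : Submodule ℂ E} [CompleteSpace K]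
    (hK : K = defectSpace T) (x : E) : defectOp T (K.starProjection x) = defectOp T x := by
  have h : x - K.starProjection x ∈ defectKer T := by
    rw [← defectSpace_orthogonal, ← hK]
    exact Submodule.sub_starProjection_mem_orthogonal _
  have h' : defectOp T (x - K.starProjection x) = 0 := h
  rw [map_sub, sub_eq_zero] at h'
  exact h'.symm

end Defect

section Contraction

variable {H : Type*} [NormedAddCommGroup H] [InnerProductSpace ℂ H] [CompleteSpace H]

/-! ### The isometric part -/

/-- By the intertwining of projections, A P_{ker D_A} = P_{ker D_{A*}} A. This makes the
construction symmetric under exchanging A and A*. -/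
theorem adjoint_isometricPart {A : H →L[ℂ] H} (hA : ‖A‖ ≤ 1) :
    (isometricPart A).adjoint = isometricPart A.adjoint := by
  have h : isometricPart A = (defectKer A.adjoint).starProjection ∘L A := by
    ext x
    exact (map_starProjection_defectKer hA x).symm
  rw [h, adjoint_comp, isSelfAdjoint_iff'.mp (isSelfAdjoint_starProjection _)]
  rfl

theorem norm_isometricPart_le {A : H →L[ℂ] H} (hA : ‖A‖ ≤ 1) : ‖isometricPart A‖ ≤ 1 := by
  refine opNorm_le_bound _ zero_le_one fun x => ?_
  rw [one_mul]
  exact (norm_apply_le_of_norm_le_one hA _).trans (Submodule.norm_starProjection_apply_le _ _)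

theorem isometricPart_apply_of_mem_defectKer {A : H →L[ℂ] H} {x : H} (hx : x ∈ defectKer A) :
    isometricPart A x = A x := by
  simp [isometricPart, Submodule.starProjection_eq_self_iff.mpr hx]

theorem isometricPart_apply_eq_zero {A : H →L[ℂ] H} {x : H} (hx : x ∈ defectSpace A) :
    isometricPart A x = 0 := by
  rw [← orthogonal_defectKer] at hx
  simp [isometricPart, (Submodule.starProjection_apply_eq_zero_iff _).mpr hx]

/-- The kernel contains 𝔇_A, so its orthogonal complement lies in ker D_A, where A is isometric. -/
theorem isPartialIsometry_isometricPart {A : H →L[ℂ] H} (hA : ‖A‖ ≤ 1) :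
    IsPartialIsometry (isometricPart A) := by
  intro x hx
  have hx' : x ∈ defectKer A := by
    rw [← defectSpace_orthogonal]
    exact Submodule.orthogonal_le (fun y hy => isometricPart_apply_eq_zero hy) hx
  rw [isometricPart_apply_of_mem_defectKer hx', norm_map_of_mem_defectKer hA hx']

theorem adjoint_comp_isometricPart {A : H →L[ℂ] H} (hA : ‖A‖ ≤ 1) (x : H) :
    (isometricPart A).adjoint (isometricPart A x) = (defectKer A).starProjection x := by
  have h : (defectKer A).starProjection x ∈ defectKer A := Submodule.starProjection_apply_mem _ _
  rw [adjoint_isometricPart hA]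
  refine (isometricPart_apply_of_mem_defectKer (map_mem_defectKer hA h)).trans ?_
  exact (mem_defectKer_iff hA _).mp h

/-- Here I - V*V is a projection, hence its own positive square root. -/
theorem defectOp_isometricPart {A : H →L[ℂ] H} (hA : ‖A‖ ≤ 1) :
    defectOp (isometricPart A) = (defectSpace A).starProjection := by
  refine CFC.sqrt_unique ?_ ?_
  · have h : 1 - (isometricPart A).adjoint ∘L isometricPart A = (defectSpace A).starProjection := by
      ext x
      simp only [← orthogonal_defectKer, Submodule.starProjection_orthogonal,
        _root_.sub_apply, ContinuousLinearMap.comp_apply,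
        adjoint_comp_isometricPart hA]
      rfl
    rw [h]
    exact (defectSpace A).isIdempotentElem_starProjection
  · rw [nonneg_iff_isPositive]
    exact IsPositive.of_isStarProjection isStarProjection_starProjection

theorem defectSpace_isometricPart {A : H →L[ℂ] H} (hA : ‖A‖ ≤ 1) :
    defectSpace (isometricPart A) = defectSpace A := by
  have h : defectKer (isometricPart A) = defectKer A := by
    rw [defectKer, defectOp_isometricPart hA, Submodule.ker_starProjection, defectSpace_orthogonal]
  rw [← orthogonal_defectKer, h, orthogonal_defectKer]

/-! ### Unitary equivalence of the two truncations -/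

theorem coe_opA10 (A : H →L[ℂ] H) (x : defectKer A) :
    (opA10 A x : H) = (defectKer A).starProjection (A x) := rfl

theorem coe_opA01 (A : H →L[ℂ] H) (x : defectKer A.adjoint) :
    (opA01 A x : H) = (defectKer A.adjoint).starProjection (A x) := rfl

/-- `A` restricted to a unitary operator from `ker D_A` onto `ker D_{A*}`. -/
theorem exists_unitary_defectKer {A : H →L[ℂ] H} (hA : ‖A‖ ≤ 1) :
    ∃ U : defectKer A ≃ₗᵢ[ℂ] defectKer A.adjoint, ∀ x, (U x : H) = A x := by
  have hU : ∀ x : defectKer A, A x ∈ defectKer A.adjoint := fun x => map_mem_defectKer hA x.2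
  let U₀ : defectKer A →ₗᵢ[ℂ] defectKer A.adjoint :=
    { toLinearMap := ((A : H →ₗ[ℂ] H) ∘ₗ (defectKer A).subtype).codRestrict _ hU
      norm_map' := fun x => norm_map_of_mem_defectKer hA x.2 }
  refine ⟨LinearIsometryEquiv.ofSurjective U₀ fun y => ?_, fun x => rfl⟩
  exact ⟨⟨A.adjoint y, adjoint_map_mem_defectKer hA y.2⟩,
    Subtype.ext (map_adjoint_of_mem_defectKer hA y.2)⟩

/-- The unitary is A itself, from ker D_A onto ker D_{A*}. -/
theorem unitarilyEquivalent_opA10_opA01 {A : H →L[ℂ] H} (hA : ‖A‖ ≤ 1) :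
    UnitarilyEquivalent (opA10 A) (opA01 A) := by
  obtain ⟨U, hU⟩ := exists_unitary_defectKer hA
  refine ⟨U, fun x => Subtype.ext ?_⟩
  rw [hU, coe_opA10, coe_opA01, hU, map_starProjection_defectKer hA]

end Contraction

end CNU

namespace CNU

/-! ### Uniqueness of the Möbius parameter. -/

section Mobius

variable {M N : Type*}
  [NormedAddCommGroup M] [InnerProductSpace ℂ M] [CompleteSpace M]
  [NormedAddCommGroup N] [InnerProductSpace ℂ N] [CompleteSpace N]

/-- D_{T*} is injective on 𝔇_{T*}, and the range of D_T is dense in 𝔇_T. -/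
theorem eq_zero_of_defectOp_comp_eq_zero (T : M →L[ℂ] N)
    (W : defectSpace T →L[ℂ] defectSpace T.adjoint)
    (h : (defectOp T.adjoint ∘L (defectSpace T.adjoint).subtypeL) ∘L W ∘L defectOpTo T = 0) :
    W = 0 := by
  have h1 : ∀ x, W (defectOpTo T x) = 0 := fun x => by
    have h2 : defectOp T.adjoint (W (defectOpTo T x)) = 0 := by
      simpa using congrArg (fun S : M →L[ℂ] N => S x) h
    exact Subtype.ext (eq_zero_of_mem_defectSpace (W (defectOpTo T x)).2 h2)
  have h3 : DenseRange (defectOpTo T) := by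
    intro y
    rw [Topology.IsInducing.subtypeVal.closure_eq_preimage_closure_image, ← Set.range_comp]
    exact y.2
  refine ContinuousLinearMap.coeFn_injective ?_
  exact h3.equalizer W.continuous continuous_const (funext h1)

/-- Since (1 + BX)⁻¹ = 1 - B · X(1 + BX)⁻¹, the product X(1 + BX)⁻¹ determines (1 + BX)⁻¹, and then
X. -/
theorem mul_inverse_one_add_injective {E F : Type*} [NormedAddCommGroup E] [NormedSpace ℂ E]
    [NormedAddCommGroup F] [NormedSpace ℂ F] {B : F →L[ℂ] E} {X Y : E →L[ℂ] F}
    (hX : IsUnit (1 + B ∘L X)) (hY : IsUnit (1 + B ∘L Y))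
    (h : X ∘L Ring.inverse (1 + B ∘L X) = Y ∘L Ring.inverse (1 + B ∘L Y)) : X = Y := by
  have key : ∀ {X : E →L[ℂ] F}, IsUnit (1 + B ∘L X) →
      Ring.inverse (1 + B ∘L X) = 1 - B ∘L (X ∘L Ring.inverse (1 + B ∘L X)) := by
    intro X hX
    have h1 := Ring.mul_inverse_cancel _ hX
    rw [add_mul, one_mul] at h1
    rw [eq_sub_iff_add_eq]
    exact h1
  have h1 : Ring.inverse (1 + B ∘L X) = Ring.inverse (1 + B ∘L Y) := by
    rw [key hX, key hY, h]
  have h2 : ∀ {X : E →L[ℂ] F}, IsUnit (1 + B ∘L X) →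
      X = (X ∘L Ring.inverse (1 + B ∘L X)) ∘L (1 + B ∘L X) := by
    intro X hX
    have h1 := Ring.inverse_mul_cancel _ hX
    rw [ContinuousLinearMap.comp_assoc]
    change X = X ∘L (Ring.inverse (1 + B ∘L X) * (1 + B ∘L X))
    rw [h1]
    rfl
  have h3 : 1 + B ∘L X = 1 + B ∘L Y := by
    refine left_inv_eq_right_inv (Ring.mul_inverse_cancel _ hX) ?_
    rw [h1]
    exact Ring.inverse_mul_cancel _ hY
  rw [h2 hX, h2 hY, h, h3]

/-- The Möbius parameter of a function is unique on the disk. -/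
theorem IsMobiusParameter.eqOn {Θ : ℂ → M →L[ℂ] N}
    {Z Z' : ℂ → defectSpace (Θ 0) →L[ℂ] defectSpace (Θ 0).adjoint}
    (hZ : IsMobiusParameter Θ Z) (hZ' : IsMobiusParameter Θ Z') :
    Set.EqOn Z Z' (Metric.ball 0 1) := by
  intro z hz
  obtain ⟨hu, he⟩ := hZ.2 z hz
  obtain ⟨hu', he'⟩ := hZ'.2 z hz
  refine mul_inverse_one_add_injective hu hu' (sub_eq_zero.mp ?_)
  refine eq_zero_of_defectOp_comp_eq_zero (Θ 0) _ ?_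
  rw [ContinuousLinearMap.sub_comp, ContinuousLinearMap.comp_sub, sub_eq_zero]
  exact add_left_cancel (he.symm.trans he')

end Mobius

/-! ### Resolvents of contractions on the disk. -/

section Resolvent

variable {H : Type*} [NormedAddCommGroup H] [InnerProductSpace ℂ H] [CompleteSpace H]

theorem isUnit_one_sub_smul {T : H →L[ℂ] H} (hT : ‖T‖ ≤ 1) {z : ℂ}
    (hz : z ∈ Metric.ball (0 : ℂ) 1) : IsUnit (1 - z • T) := by
  apply isUnit_one_sub_of_norm_lt_one
  rw [norm_smul]
  rw [mem_ball_zero_iff] at hz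
  nlinarith [norm_nonneg z, norm_nonneg T]

theorem inverse_one_sub_smul_apply_eq_iff {T : H →L[ℂ] H} (hT : ‖T‖ ≤ 1) {z : ℂ}
    (hz : z ∈ Metric.ball (0 : ℂ) 1) {x y : H} :
    Ring.inverse (1 - z • T) x = y ↔ y - z • T y = x := by
  have hu := isUnit_one_sub_smul hT hz
  constructor
  · rintro rfl
    simpa using congrArg (fun S : H →L[ℂ] H => S x) (Ring.mul_inverse_cancel _ hu)
  · rintro rfl
    simpa using congrArg (fun S : H →L[ℂ] H => S y) (Ring.inverse_mul_cancel _ hu)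

theorem inverse_one_sub_smul_apply {T : H →L[ℂ] H} (hT : ‖T‖ ≤ 1) {z : ℂ}
    (hz : z ∈ Metric.ball (0 : ℂ) 1) (x : H) :
    Ring.inverse (1 - z • T) x - z • T (Ring.inverse (1 - z • T) x) = x :=
  (inverse_one_sub_smul_apply_eq_iff hT hz).mp rfl

theorem differentiableOn_inverse_one_sub_smul {T : H →L[ℂ] H} (hT : ‖T‖ ≤ 1) :
    DifferentiableOn ℂ (fun z : ℂ => Ring.inverse (1 - z • T)) (Metric.ball 0 1) := by
  intro z hz
  have h : DifferentiableAt ℂ (fun z : ℂ => 1 - z • T) z := by fun_prop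
  exact ((differentiableAt_inverse (𝕜 := ℂ) (isUnit_one_sub_smul hT hz)).comp z
    h).differentiableWithinAt

end Resolvent

section Contraction

variable {H : Type*} [NormedAddCommGroup H] [InnerProductSpace ℂ H] [CompleteSpace H]

theorem norm_isometricPart_adjoint_le {A : H →L[ℂ] H} (hA : ‖A‖ ≤ 1) :
    ‖(isometricPart A).adjoint‖ ≤ 1 :=
  norm_adjoint_le_one (norm_isometricPart_le hA)

theorem isometricPart_adjoint_mem_defectKer {A : H →L[ℂ] H} (hA : ‖A‖ ≤ 1) (x : H) :
    (isometricPart A).adjoint x ∈ defectKer A := by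
  rw [adjoint_isometricPart hA]
  exact adjoint_map_mem_defectKer hA (Submodule.starProjection_apply_mem _ _)

theorem norm_isometricPart_adjoint_apply {A : H →L[ℂ] H} (hA : ‖A‖ ≤ 1) (x : H) :
    ‖(isometricPart A).adjoint x‖ = ‖(defectKer A.adjoint).starProjection x‖ := by
  rw [adjoint_isometricPart hA]
  exact norm_map_of_mem_defectKer (norm_adjoint_le_one hA) (Submodule.starProjection_apply_mem _ _)

variable {K L : Submodule ℂ H} [CompleteSpace K] [CompleteSpace L]
  {K' : Submodule ℂ K} {L' : Submodule ℂ L} [CompleteSpace K'] [CompleteSpace L']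
  {A : H →L[ℂ] H} {Θ : ℂ → K →L[ℂ] L}

/-- `A* = (A P_{ker D_A})* + A* P_{𝔇_{A*}}`. -/
theorem isometricPart_adjoint_add (hA : ‖A‖ ≤ 1) (hL : L = defectSpace A.adjoint) (x : H) :
    (isometricPart A).adjoint x + A.adjoint (L.starProjection x) = A.adjoint x := by
  rw [adjoint_isometricPart hA]
  simp only [hL, ← orthogonal_defectKer]
  rw [isometricPart, ContinuousLinearMap.comp_apply, ← map_add,
    Submodule.starProjection_add_starProjection_orthogonal]

/-! ### The characteristic function of the isometric part as an operator function -/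

variable (K' L') in
/-- The function `z P_L (I - z (A P_{ker D_A})*)⁻¹ ↾ K`, with values in the operators from a
subspace `K'` of `K` to a subspace `L'` of `L`. For `K' = K = 𝔇_A` and `L' = L = 𝔇_{A*}` it is the
characteristic function of `A P_{ker D_A}`. -/
noncomputable def mobiusBetween (A : H →L[ℂ] H) (z : ℂ) : K' →L[ℂ] L' :=
  between K' L' (between K L (z • Ring.inverse (1 - z • (isometricPart A).adjoint)))

-- K' and L' stand for 𝔇_{Θ(0)} and 𝔇_{Θ(0)*}, which fill K and L only by a proved equality. Taking
-- that equality as a hypothesis makes the outer compression harmless.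
omit [CompleteSpace K'] in
theorem coe_mobiusBetween (hL' : L' = ⊤) (z : ℂ) (f : K') :
    ((mobiusBetween K' L' A z f : L) : H) = z • L.starProjection
      (Ring.inverse (1 - z • (isometricPart A).adjoint) ((f : K) : H)) := by
  unfold mobiusBetween
  rw [coe_between_of_mem _ _ _ _ (by rw [hL']; trivial), coe_between, _root_.smul_apply, map_smul]

theorem coe_adjoint_mobiusBetween (hK' : K' = ⊤) (z : ℂ) (g : L') :
    ((adjoint (𝕜 := ℂ) (E := K') (F := L') (mobiusBetween K' L' A (starRingEnd ℂ z)) g : K) : H) =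
      z • K.starProjection (Ring.inverse (1 - z • isometricPart A) ((g : L) : H)) := by
  have h : (starRingEnd ℂ z • Ring.inverse
      (1 - starRingEnd ℂ z • (isometricPart A).adjoint)).adjoint =
        z • Ring.inverse (1 - z • isometricPart A) := by
    rw [← star_eq_adjoint, ← star_eq_adjoint, star_smul, ← Ring.inverse_star, star_sub, star_one,
      star_smul, star_star, RCLike.star_def, Complex.conj_conj]
  rw [mobiusBetween, adjoint_between, adjoint_between, h,
    coe_between_of_mem _ _ _ _ (by rw [hK']; trivial), coe_between, _root_.smul_apply, map_smul]

-- Put h = (I - zV*)⁻¹ f. As f ⟂ V*h, ‖h‖² = ‖f‖² + |z|²‖V*h‖², while ‖h‖² = ‖V*h‖² + ‖P_L h‖².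
-- Therefore ‖z P_L h‖² = ‖f‖² - (1 - |z|²)‖h‖².
omit [CompleteSpace K] [CompleteSpace K'] in
theorem norm_mobiusBetween_le (hA : ‖A‖ ≤ 1) (hK : K = defectSpace A)
    (hL : L = defectSpace A.adjoint) {z : ℂ} (hz : z ∈ Metric.ball (0 : ℂ) 1) :
    ‖mobiusBetween K' L' A z‖ ≤ 1 := by
  refine norm_between_le _ _ (opNorm_le_bound _ zero_le_one fun f => ?_)
  rw [one_mul, Submodule.coe_norm, Submodule.coe_norm, coe_between, _root_.smul_apply, map_smul]
  have h1 := inverse_one_sub_smul_apply (norm_isometricPart_adjoint_le hA) hz (f : H)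
  set h := Ring.inverse (1 - z • (isometricPart A).adjoint) (f : H)
  have h2 : ‖h‖ * ‖h‖ = ‖(f : H)‖ * ‖(f : H)‖ +
      ‖z • (isometricPart A).adjoint h‖ * ‖z • (isometricPart A).adjoint h‖ := by
    rw [← norm_add_sq_eq_norm_sq_add_norm_sq_of_inner_eq_zero (𝕜 := ℂ), ← sub_eq_iff_eq_add.mp h1]
    rw [inner_smul_right, inner_eq_zero_symm.mp ((mem_defectSpace_iff A _).mp (hK ▸ f.2) _
      (isometricPart_adjoint_mem_defectKer hA h)), mul_zero]
  have h3 := Submodule.norm_sq_eq_add_norm_sq_starProjection h (defectKer A.adjoint)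
  rw [← norm_isometricPart_adjoint_apply hA] at h3
  simp only [orthogonal_defectKer, ← hL] at h3
  rw [norm_smul] at h2 ⊢
  rw [mem_ball_zero_iff] at hz
  have hz2 : ‖z‖ ^ 2 ≤ 1 := by nlinarith [norm_nonneg z]
  refine le_of_sq_le_sq ?_ (norm_nonneg _)
  nlinarith [mul_nonneg (sub_nonneg.mpr hz2) (sq_nonneg ‖h‖)]

omit [CompleteSpace K] [CompleteSpace K'] in
theorem differentiableOn_mobiusBetween (hA : ‖A‖ ≤ 1) :
    DifferentiableOn ℂ (mobiusBetween K' L' A) (Metric.ball 0 1) := by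
  have h := differentiableOn_id.smul
    (differentiableOn_inverse_one_sub_smul (norm_isometricPart_adjoint_le hA))
  unfold mobiusBetween between
  exact (differentiableOn_const _).clm_comp (((differentiableOn_const _).clm_comp
    (h.clm_comp (differentiableOn_const _))).clm_comp (differentiableOn_const _))

omit [CompleteSpace K'] in
theorem le_iff_forall_eq_smul (hA : ‖A‖ ≤ 1) (hL : L = defectSpace A.adjoint)
    (hK' : K' = ⊤) (hL' : L' = ⊤) {Z : ℂ → K' →L[ℂ] L'}
    (hZ : Set.EqOn Z (mobiusBetween K' L' A) (Metric.ball 0 1)) :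
    K ≤ L ↔ ∀ z ∈ Metric.ball (0 : ℂ) 1, ∀ f : K', ((Z z f : L) : H) = z • ((f : K) : H) := by
  constructor
  · intro hle z hz f
    have hf := hle (f : K).2
    have h1 : Ring.inverse (1 - z • (isometricPart A).adjoint) ((f : K) : H) = ((f : K) : H) := by
      rw [inverse_one_sub_smul_apply_eq_iff (norm_isometricPart_adjoint_le hA) hz,
        adjoint_isometricPart hA, isometricPart_apply_eq_zero (hL ▸ hf), smul_zero, sub_zero]
    rw [hZ hz, coe_mobiusBetween hL', h1, Submodule.starProjection_eq_self_iff.mpr hf]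
  · intro h f hf
    -- Any nonzero point of the disk would serve.
    have hz : (1 / 2 : ℂ) ∈ Metric.ball (0 : ℂ) 1 := by
      rw [mem_ball_zero_iff]
      norm_num
    have hf' : (⟨_, hf⟩ : K) ∈ K' := hK' ▸ trivial
    have h2 : (1 / 2 : ℂ) • f ∈ L := by
      rw [← h _ hz ⟨⟨f, hf⟩, hf'⟩]
      exact Subtype.coe_prop _
    exact (Submodule.smul_mem_iff _ (by norm_num)).mp h2

/-- The mirror image of `le_iff_forall_eq_smul`: taking adjoints at the conjugate point replaces V*
by V, which vanishes on K. -/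
theorem le_iff_forall_adjoint_eq_smul (hA : ‖A‖ ≤ 1) (hK : K = defectSpace A)
    (hK' : K' = ⊤) (hL' : L' = ⊤) {Z : ℂ → K' →L[ℂ] L'}
    (hZ : Set.EqOn Z (mobiusBetween K' L' A) (Metric.ball 0 1)) :
    L ≤ K ↔ ∀ z ∈ Metric.ball (0 : ℂ) 1, ∀ g : L',
      ((adjoint (𝕜 := ℂ) (E := K') (F := L') (Z (starRingEnd ℂ z)) g : K) : H) =
        z • ((g : L) : H) := by
  constructor
  · intro hle z hz g
    have hg := hle (g : L).2
    have h1 : Ring.inverse (1 - z • isometricPart A) ((g : L) : H) = ((g : L) : H) := by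
      rw [inverse_one_sub_smul_apply_eq_iff (norm_isometricPart_le hA) hz,
        isometricPart_apply_eq_zero (hK ▸ hg), smul_zero, sub_zero]
    have hz' : starRingEnd ℂ z ∈ Metric.ball (0 : ℂ) 1 := by simpa using hz
    rw [hZ hz', coe_adjoint_mobiusBetween hK', h1, Submodule.starProjection_eq_self_iff.mpr hg]
  · intro h g hg
    have hz : (1 / 2 : ℂ) ∈ Metric.ball (0 : ℂ) 1 := by
      rw [mem_ball_zero_iff]
      norm_num
    have hg' : (⟨_, hg⟩ : L) ∈ L' := hL' ▸ trivial
    have h2 : (1 / 2 : ℂ) • g ∈ K := by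
      rw [← h _ hz ⟨⟨g, hg⟩, hg'⟩]
      exact Subtype.coe_prop _
    exact (Submodule.smul_mem_iff _ (by norm_num)).mp h2

/-! ### The denominator of the Möbius transformation -/

theorem coe_one_add_comp_mobiusBetween {B : L →L[ℂ] K} (hB : ∀ g : L, (B g : H) = -A.adjoint g)
    (hK' : K' = ⊤) (hL' : L' = ⊤) (z : ℂ) (w : K') :
    (((1 + between L' K' B ∘L mobiusBetween K' L' A z) w : K) : H) = ((w : K) : H) -
      z • A.adjoint (L.starProjection
        (Ring.inverse (1 - z • (isometricPart A).adjoint) ((w : K) : H))) := by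
  rw [_root_.add_apply, one_apply_eq_self, ContinuousLinearMap.comp_apply,
    Submodule.coe_add, Submodule.coe_add, coe_between_of_mem _ _ _ _ (hK' ▸ trivial), hB,
    coe_mobiusBetween hL', map_smul, ← sub_eq_add_neg]

/-- This is the factorization of the denominator as (I - zA*)(I - zV*)⁻¹, a consequence of A* = V* +
A* P_L. -/
theorem inverse_one_sub_smul_one_add_comp_mobiusBetween (hA : ‖A‖ ≤ 1)
    (hL : L = defectSpace A.adjoint) {B : L →L[ℂ] K} (hB : ∀ g : L, (B g : H) = -A.adjoint g)
    (hK' : K' = ⊤) (hL' : L' = ⊤) {z : ℂ} (hz : z ∈ Metric.ball (0 : ℂ) 1) (w : K') :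
    Ring.inverse (1 - z • A.adjoint)
        (((1 + between L' K' B ∘L mobiusBetween K' L' A z) w : K) : H) =
      Ring.inverse (1 - z • (isometricPart A).adjoint) ((w : K) : H) := by
  rw [inverse_one_sub_smul_apply_eq_iff (norm_adjoint_le_one hA) hz,
    coe_one_add_comp_mobiusBetween hB hK' hL', ← isometricPart_adjoint_add hA hL, smul_add,
    ← sub_sub, inverse_one_sub_smul_apply (norm_isometricPart_adjoint_le hA) hz]

theorem isUnit_one_add_comp_mobiusBetween (hA : ‖A‖ ≤ 1) (hK : K = defectSpace A)
    (hL : L = defectSpace A.adjoint) {B : L →L[ℂ] K} (hB : ∀ g : L, (B g : H) = -A.adjoint g)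
    (hK' : K' = ⊤) (hL' : L' = ⊤) {z : ℂ} (hz : z ∈ Metric.ball (0 : ℂ) 1) :
    IsUnit (1 + between L' K' B ∘L mobiusBetween K' L' A z) := by
  have hV := norm_isometricPart_adjoint_le hA
  -- By the open mapping theorem, bijectivity suffices for a bounded inverse.
  rw [isUnit_iff_bijective]
  constructor
  · rw [injective_iff_map_eq_zero]
    intro w hw
    have h1 := inverse_one_sub_smul_one_add_comp_mobiusBetween hA hL hB hK' hL' hz w
    rw [hw, Submodule.coe_zero, Submodule.coe_zero, map_zero] at h1
    have h2 := (inverse_one_sub_smul_apply_eq_iff hV hz).mp h1.symm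
    rw [map_zero, smul_zero, sub_zero] at h2
    exact Subtype.ext (Subtype.ext h2.symm)
  · intro u
    -- The preimage of u is k = (I - zV*)(I - zA*)⁻¹ u = u + z A* P_L h. It lies in K because A*
    -- maps L into K.
    obtain ⟨h, hh⟩ : ∃ h : H, h - z • A.adjoint h = ((u : K) : H) :=
      ⟨_, inverse_one_sub_smul_apply (norm_adjoint_le_one hA) hz _⟩
    obtain ⟨k, hk⟩ : ∃ k : H, h - z • (isometricPart A).adjoint h = k := ⟨_, rfl⟩
    have h2 : k = ((u : K) : H) + z • A.adjoint (L.starProjection h) := by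
      rw [← hk, ← hh, ← isometricPart_adjoint_add hA hL h]
      module
    have h3 : k ∈ K := by
      rw [h2]
      refine add_mem (u : K).2 (Submodule.smul_mem _ _ ?_)
      exact hK ▸ adjoint_map_mem_defectSpace hA (hL ▸ Submodule.starProjection_apply_mem L h)
    have h4 : (⟨_, h3⟩ : K) ∈ K' := hK' ▸ trivial
    refine ⟨⟨⟨_, h3⟩, h4⟩, Subtype.ext (Subtype.ext ?_)⟩
    rw [coe_one_add_comp_mobiusBetween hB hK' hL',
      (inverse_one_sub_smul_apply_eq_iff hV hz).mpr hk]
    exact sub_eq_iff_eq_add.mpr h2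

/-! ### The Möbius parameter of the characteristic function -/

/-- `Θ` is the characteristic function of `A`, between subspaces `K` and `L` that are only
propositionally equal to `𝔇_A` and `𝔇_{A*}`. -/
structure IsCharFunOf (A : H →L[ℂ] H) (Θ : ℂ → K →L[ℂ] L) : Prop where
  dom_eq : K = defectSpace A
  cod_eq : L = defectSpace A.adjoint
  coe_apply : ∀ z f, (Θ z f : H) = -A f +
    z • defectOp A.adjoint (Ring.inverse (1 - z • A.adjoint) (defectOp A f))

theorem isCharFunOf_charFun (hA : ‖A‖ ≤ 1) : IsCharFunOf A (charFun A) :=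
  ⟨rfl, rfl, coe_charFun hA⟩

namespace IsCharFunOf

omit [CompleteSpace K] [CompleteSpace L] in
theorem coe_zero (h : IsCharFunOf A Θ) (f : K) : (Θ 0 f : H) = -A f := by
  rw [h.coe_apply, zero_smul, add_zero]

omit [CompleteSpace K] in
theorem zero_eq (hA : ‖A‖ ≤ 1) (h : IsCharFunOf A Θ) : Θ 0 = -between K L A := by
  refine ContinuousLinearMap.ext fun f => Subtype.ext ?_
  rw [h.coe_zero, _root_.neg_apply, Submodule.coe_neg, coe_between_of_mem]
  exact h.cod_eq ▸ map_mem_defectSpace hA (h.dom_eq ▸ f.2)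

theorem adjoint_zero_eq (hA : ‖A‖ ≤ 1) (h : IsCharFunOf A Θ) :
    (Θ 0).adjoint = -between L K A.adjoint := by
  rw [h.zero_eq hA, map_neg, adjoint_between]

theorem coe_adjoint_zero (hA : ‖A‖ ≤ 1) (h : IsCharFunOf A Θ) (g : L) :
    ((Θ 0).adjoint g : H) = -A.adjoint g := by
  rw [h.adjoint_zero_eq hA, _root_.neg_apply, Submodule.coe_neg, coe_between_of_mem]
  exact h.dom_eq ▸ adjoint_map_mem_defectSpace hA (h.cod_eq ▸ g.2)

theorem coe_defectOp_zero (hA : ‖A‖ ≤ 1) (h : IsCharFunOf A Θ) (f : K) :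
    (defectOp (Θ 0) f : H) = defectOp A f := by
  rw [h.zero_eq hA, defectOp_neg, coe_defectOp_between hA h.dom_eq h.cod_eq]

theorem coe_defectOp_adjoint_zero (hA : ‖A‖ ≤ 1) (h : IsCharFunOf A Θ) (g : L) :
    (defectOp (Θ 0).adjoint g : H) = defectOp A.adjoint g := by
  rw [h.adjoint_zero_eq hA, defectOp_neg, coe_defectOp_between (norm_adjoint_le_one hA) h.cod_eq]
  rw [adjoint_adjoint, h.dom_eq]

/-- D_{Θ(0)} is D_A restricted to 𝔇_A, where it is injective; being self-adjoint, it has dense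
range. -/
theorem defectSpace_zero (hA : ‖A‖ ≤ 1) (h : IsCharFunOf A Θ) : defectSpace (Θ 0) = ⊤ := by
  have hmem : ∀ x : K, (x : H) ∈ defectSpace A := fun x => h.dom_eq ▸ x.2
  refine defectSpace_eq_top fun x hx => Subtype.ext (eq_zero_of_mem_defectSpace (hmem x) ?_)
  rw [← h.coe_defectOp_zero hA, hx, Submodule.coe_zero]

theorem defectSpace_adjoint_zero (hA : ‖A‖ ≤ 1) (h : IsCharFunOf A Θ) :
    defectSpace (Θ 0).adjoint = ⊤ := by
  have hmem : ∀ x : L, (x : H) ∈ defectSpace A.adjoint := fun x => h.cod_eq ▸ x.2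
  refine defectSpace_eq_top fun x hx => Subtype.ext (eq_zero_of_mem_defectSpace (hmem x) ?_)
  rw [← h.coe_defectOp_adjoint_zero hA, hx, Submodule.coe_zero]

theorem map_defectSpace_zero (hA : ‖A‖ ≤ 1) (h : IsCharFunOf A Θ) :
    (defectSpace (Θ 0)).map K.subtype = K := by
  rw [h.defectSpace_zero hA, Submodule.map_subtype_top]

theorem map_defectSpace_adjoint_zero (hA : ‖A‖ ≤ 1) (h : IsCharFunOf A Θ) :
    (defectSpace (Θ 0).adjoint).map L.subtype = L := by
  rw [h.defectSpace_adjoint_zero hA, Submodule.map_subtype_top]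

/-- The Möbius formula without an inverse: w plays the role of R⁻¹ D_{Θ(0)} f, R being the
denominator. The projection P_L disappears under D_{A*}. -/
theorem eq_add_of_denominator_eq (hA : ‖A‖ ≤ 1) (h : IsCharFunOf A Θ) (hK' : K' = ⊤)
    (hL' : L' = ⊤) {z : ℂ} (hz : z ∈ Metric.ball (0 : ℂ) 1) (f : K) (w : K')
    (hw : (((1 + between L' K' (Θ 0).adjoint ∘L mobiusBetween K' L' A z) w : K) : H) =
      defectOp A f) :
    Θ z f = Θ 0 f + defectOp (Θ 0).adjoint (mobiusBetween K' L' A z w) := by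
  refine Subtype.ext ?_
  rw [Submodule.coe_add, h.coe_zero, h.coe_apply, h.coe_defectOp_adjoint_zero hA,
    coe_mobiusBetween hL', map_smul, defectOp_starProjection h.cod_eq, ← hw,
    inverse_one_sub_smul_one_add_comp_mobiusBetween hA h.cod_eq (h.coe_adjoint_zero hA) hK' hL' hz]

theorem isMobiusParameter (hA : ‖A‖ ≤ 1) (h : IsCharFunOf A Θ) :
    IsMobiusParameter Θ (mobiusBetween (defectSpace (Θ 0)) (defectSpace (Θ 0).adjoint) A) := by
  have hK' := h.defectSpace_zero hA
  have hL' := h.defectSpace_adjoint_zero hA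
  refine ⟨⟨differentiableOn_mobiusBetween hA,
    fun z hz => norm_mobiusBetween_le hA h.dom_eq h.cod_eq hz⟩, fun z hz => ?_⟩
  have hu := isUnit_one_add_comp_mobiusBetween hA h.dom_eq h.cod_eq (h.coe_adjoint_zero hA)
    hK' hL' hz
  refine ⟨hu, ContinuousLinearMap.ext fun f => ?_⟩
  refine h.eq_add_of_denominator_eq hA hK' hL' hz f _ ?_
  refine (congrArg (fun x : defectSpace (Θ 0) => ((x : K) : H)) (DFunLike.congr_fun
    (Ring.mul_inverse_cancel _ hu) (defectOpTo (Θ 0) f))).trans ?_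
  exact h.coe_defectOp_zero hA f

variable {Z : ℂ → defectSpace (Θ 0) →L[ℂ] defectSpace (Θ 0).adjoint}

theorem eqOn_mobiusBetween (hA : ‖A‖ ≤ 1) (h : IsCharFunOf A Θ) (hZ : IsMobiusParameter Θ Z) :
    Set.EqOn Z (mobiusBetween _ _ A) (Metric.ball 0 1) :=
  hZ.eqOn (h.isMobiusParameter hA)

theorem coe_mobiusParameter (hA : ‖A‖ ≤ 1) (h : IsCharFunOf A Θ) (hZ : IsMobiusParameter Θ Z)
    {z : ℂ} (hz : z ∈ Metric.ball (0 : ℂ) 1) (f : defectSpace (Θ 0)) :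
    ((Z z f : L) : H) = z • L.starProjection
      (Ring.inverse (1 - z • (isometricPart A).adjoint) ((f : K) : H)) := by
  rw [h.eqOn_mobiusBetween hA hZ hz]
  exact coe_mobiusBetween (h.defectSpace_adjoint_zero hA) z f

theorem le_iff_mobiusParameter_eq_smul (hA : ‖A‖ ≤ 1) (h : IsCharFunOf A Θ)
    (hZ : IsMobiusParameter Θ Z) :
    K ≤ L ↔ ∀ z ∈ Metric.ball (0 : ℂ) 1, ∀ f : defectSpace (Θ 0),
      ((Z z f : L) : H) = z • ((f : K) : H) :=
  le_iff_forall_eq_smul hA h.cod_eq (h.defectSpace_zero hA) (h.defectSpace_adjoint_zero hA)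
    (h.eqOn_mobiusBetween hA hZ)

theorem le_iff_adjoint_mobiusParameter_eq_smul (hA : ‖A‖ ≤ 1) (h : IsCharFunOf A Θ)
    (hZ : IsMobiusParameter Θ Z) :
    L ≤ K ↔ ∀ z ∈ Metric.ball (0 : ℂ) 1, ∀ g : defectSpace (Θ 0).adjoint,
      (((Z (starRingEnd ℂ z)).adjoint g : K) : H) = z • ((g : L) : H) :=
  le_iff_forall_adjoint_eq_smul hA h.dom_eq (h.defectSpace_zero hA)
    (h.defectSpace_adjoint_zero hA) (h.eqOn_mobiusBetween hA hZ)

end IsCharFunOf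

theorem coe_charFun_isometricPart (hA : ‖A‖ ≤ 1) (z : ℂ) (g : defectSpace (isometricPart A)) :
    (charFun (isometricPart A) z g : H) = z • (defectSpace A.adjoint).starProjection
      (Ring.inverse (1 - z • (isometricPart A).adjoint) (g : H)) := by
  have hg : (g : H) ∈ defectSpace A := by
    rw [← defectSpace_isometricPart hA]
    exact g.2
  have hD : defectOp (isometricPart A).adjoint = (defectSpace A.adjoint).starProjection := by
    rw [adjoint_isometricPart hA, defectOp_isometricPart (norm_adjoint_le_one hA)]
  rw [coe_charFun (norm_isometricPart_le hA), isometricPart_apply_eq_zero hg, hD,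
    defectOp_isometricPart hA, Submodule.starProjection_eq_self_iff.mpr hg, neg_zero, zero_add]

end Contraction

end CNU

namespace CNU

/-! ### Wold decomposition and the shift criteria. -/

section Shift

variable {H H₁ H₂ : Type*}
  [NormedAddCommGroup H] [InnerProductSpace ℂ H] [CompleteSpace H]
  [NormedAddCommGroup H₁] [InnerProductSpace ℂ H₁] [CompleteSpace H₁]
  [NormedAddCommGroup H₂] [InnerProductSpace ℂ H₂] [CompleteSpace H₂]

/-- The Wold decomposition: an isometry `S` such that the intersection of the ranges of its powers
is trivial is a unilateral shift. -/
theorem isUnilateralShift_of_isometry {S : H →L[ℂ] H} (hS : ∀ f, ‖S f‖ = ‖f‖)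
    (hpure : ∀ f, (∀ n : ℕ, ∃ g, (S ^ n) g = f) → f = 0) : IsUnilateralShift S := by
  have hin : ∀ (n : ℕ) (x y : H), inner ℂ ((S ^ n) x) ((S ^ n) y) = inner ℂ x y := by
    intro n x y
    induction n with
    | zero => rfl
    | succ n ih =>
      rw [pow_succ']
      exact ((LinearMap.norm_map_iff_inner_map_map S).mp hS _ _).trans ih
  have hclosed : IsClosed (S.range : Set H) :=
    (AddMonoidHomClass.isometry_of_norm S hS).isClosedEmbedding.isClosed_range
  have horth : ∀ (p k : ℕ), ∀ x ∈ S.rangeᗮ, ∀ y : H,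
      inner ℂ ((S ^ p) x) ((S ^ (p + (k + 1))) y) = 0 := by
    intro p k x hx y
    rw [pow_add]
    change inner ℂ ((S ^ p) x) ((S ^ p) ((S ^ (k + 1)) y)) = 0
    rw [hin, pow_succ']
    exact (Submodule.mem_orthogonal' _ _).mp hx _ ⟨_, rfl⟩
  -- The wandering subspace is the orthogonal complement of the range.
  refine ⟨hS, S.rangeᗮ, Submodule.isClosed_orthogonal _, fun p q hpq => ?_, ?_⟩
  · rw [Submodule.isOrtho_iff_inner_eq]
    rintro _ ⟨x, hx, rfl⟩ _ ⟨y, hy, rfl⟩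
    rcases hpq.lt_or_gt with h | h
    · obtain ⟨k, rfl⟩ := Nat.exists_eq_add_of_lt h
      exact horth p k x hx y
    · obtain ⟨k, rfl⟩ := Nat.exists_eq_add_of_lt h
      exact inner_eq_zero_symm.mp (horth q k y hy x)
  · rw [Submodule.topologicalClosure_eq_top_iff, Submodule.eq_bot_iff]
    intro f hf
    refine hpure f fun n => ?_
    induction n with
    | zero => exact ⟨f, rfl⟩
    | succ n ih =>
      obtain ⟨g, rfl⟩ := ih
      -- If f = Sⁿ g is orthogonal to Sⁿ Ω, then g ⟂ Ω, so g lies in the range of S, which is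
      -- closed. One more power of S thus splits off f.
      have hg : g ∈ S.rangeᗮᗮ := by
        rw [Submodule.mem_orthogonal]
        intro u hu
        rw [← hin n]
        exact (Submodule.mem_orthogonal _ _).mp hf _
          (Submodule.mem_iSup_of_mem n (Submodule.mem_map_of_mem hu))
      rw [Submodule.orthogonal_orthogonal_eq_closure,
        hclosed.submodule_topologicalClosure_eq] at hg
      obtain ⟨k, rfl⟩ := hg
      exact ⟨k, by rw [pow_succ]; rfl⟩

omit [CompleteSpace H₁] [CompleteSpace H₂] in
theorem UnitarilyEquivalent.symm {S : H₁ →L[ℂ] H₁} {T : H₂ →L[ℂ] H₂}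
    (h : UnitarilyEquivalent S T) : UnitarilyEquivalent T S := by
  obtain ⟨U, hU⟩ := h
  refine ⟨U.symm, fun f => ?_⟩
  rw [U.symm_apply_eq, hU, U.apply_symm_apply]

theorem UnitarilyEquivalent.isUnilateralShift {S : H₁ →L[ℂ] H₁} {T : H₂ →L[ℂ] H₂}
    (h : UnitarilyEquivalent S T) (hS : IsUnilateralShift S) : IsUnilateralShift T := by
  obtain ⟨U, hU⟩ := h
  obtain ⟨hiso, Ω, hΩ, horth, hspan⟩ := hS
  have hpow : ∀ (n : ℕ) (f : H₁), U ((S ^ n) f) = (T ^ n) (U f) := by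
    intro n f
    induction n with
    | zero => rfl
    | succ n ih =>
      rw [pow_succ', pow_succ']
      change U (S ((S ^ n) f)) = T ((T ^ n) (U f))
      rw [hU, ih]
  have hmap : ∀ n : ℕ,
      (Ω.map (U.toLinearEquiv : H₁ →ₗ[ℂ] H₂)).map ((T ^ n : H₂ →L[ℂ] H₂) : H₂ →ₗ[ℂ] H₂) =
      (Ω.map ((S ^ n : H₁ →L[ℂ] H₁) : H₁ →ₗ[ℂ] H₁)).map (U.toLinearEquiv : H₁ →ₗ[ℂ] H₂) := by
    intro n
    rw [← Submodule.map_comp, ← Submodule.map_comp]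
    congr 1
    ext f
    exact (hpow n f).symm
  refine ⟨fun f => ?_, Ω.map (U.toLinearEquiv : H₁ →ₗ[ℂ] H₂), ?_, fun p q hpq => ?_, ?_⟩
  · obtain ⟨f, rfl⟩ := U.surjective f
    rw [← hU, U.norm_map, U.norm_map, hiso]
  · exact U.toHomeomorph.isClosedMap _ hΩ
  · rw [hmap, hmap, Submodule.isOrtho_iff_inner_eq]
    rintro _ ⟨x, hx, rfl⟩ _ ⟨y, hy, rfl⟩
    exact (U.inner_map_map x y).trans (Submodule.isOrtho_iff_inner_eq.mp (horth p q hpq) x hx y hy)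
  · rw [Submodule.topologicalClosure_eq_top_iff] at hspan ⊢
    simp only [hmap]
    rw [← Submodule.map_iSup, Submodule.eq_bot_iff]
    intro f hf
    obtain ⟨f, rfl⟩ := U.surjective f
    have h0 : f = 0 := by
      refine (Submodule.eq_bot_iff _).mp hspan f ((Submodule.mem_orthogonal _ _).mpr fun u hu => ?_)
      rw [← U.inner_map_map]
      exact (Submodule.mem_orthogonal _ _).mp hf _ (Submodule.mem_map_of_mem hu)
    rw [h0, map_zero]

/-- Where A* is isometric, A A* = I. So on a subspace reducing A* to a unitary, A acts as the
inverse unitary. -/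
theorem IsCompletelyNonUnitary.adjoint {A : H →L[ℂ] H} (hA : ‖A‖ ≤ 1)
    (h : IsCompletelyNonUnitary A) : IsCompletelyNonUnitary A.adjoint := by
  intro K hK h1 h2 h3 h4
  rw [adjoint_adjoint] at h2
  have h5 : ∀ f ∈ K, A (A.adjoint f) = f := fun f hf => by
    have hk : f ∈ defectKer A.adjoint := by
      have h6 := defectOp_defectOp_apply (norm_adjoint_le_one hA) f
      have h7 : inner ℂ (defectOp A.adjoint f) (defectOp A.adjoint f) = 0 := by
        rw [← inner_defectOp_left, h6, inner_sub_left, adjoint_adjoint, ← adjoint_inner_right,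
          inner_self_eq_norm_sq_to_K, inner_self_eq_norm_sq_to_K, h3 f hf, sub_self]
      exact inner_self_eq_zero.mp h7
    exact map_adjoint_of_mem_defectKer hA hk
  refine h K hK h2 h1 (fun f hf => ?_) fun g hg => ⟨_, h1 g hg, h5 g hg⟩
  obtain ⟨g, hg, rfl⟩ := h4 f hf
  rw [h5 g hg, h3 g hg]

/-- A already preserves norms on ker D_A, so a compression that loses no norm leaves no component of
A f in 𝔇_A. -/
theorem map_mem_defectKer_of_norm_opA10 {A : H →L[ℂ] H} (hA : ‖A‖ ≤ 1)
    (h : ∀ f, ‖opA10 A f‖ = ‖f‖) {f : H} (hf : f ∈ defectKer A) : A f ∈ defectKer A := by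
  have h1 : ‖(defectKer A).starProjection (A f)‖ = ‖A f‖ :=
    (h ⟨f, hf⟩).trans (norm_map_of_mem_defectKer hA hf).symm
  have h2 := Submodule.norm_sq_eq_add_norm_sq_starProjection (A f) (defectKer A)
  rw [h1, left_eq_add, sq_eq_zero_iff, norm_eq_zero, Submodule.starProjection_apply_eq_zero_iff,
    Submodule.orthogonal_orthogonal] at h2
  exact h2

/-- For a completely non-unitary contraction, `A_{1,0}` is a unilateral shift if and only if
`𝔇_A ⊂ 𝔇_{A*}`. -/
theorem isUnilateralShift_opA10_iff {A : H →L[ℂ] H} (hA : ‖A‖ ≤ 1)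
    (hcnu : IsCompletelyNonUnitary A) :
    IsUnilateralShift (opA10 A) ↔ defectSpace A ≤ defectSpace A.adjoint := by
  rw [← defectKer_le_iff]
  constructor
  · rintro ⟨hiso, -⟩ g hg
    -- Every g in ker D_{A*} is the image under A of A*g, which lies in ker D_A.
    rw [← map_adjoint_of_mem_defectKer hA hg]
    exact map_mem_defectKer_of_norm_opA10 hA hiso (adjoint_map_mem_defectKer hA hg)
  · intro hle
    have hmap : ∀ f : defectKer A, (opA10 A f : H) = A f := fun f =>
      coe_between_of_mem _ _ _ _ (hle (map_mem_defectKer hA f.2))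
    have hiso : ∀ f, ‖opA10 A f‖ = ‖f‖ := fun f => by
      rw [Submodule.coe_norm, hmap, norm_map_of_mem_defectKer hA f.2, Submodule.coe_norm]
    have hpow : ∀ n : ℕ,
        IsClosed (((opA10 A ^ n).range.map (defectKer A).subtype : Submodule ℂ H) : Set H) := by
      intro n
      have hn : ∀ f, ‖(opA10 A ^ n) f‖ = ‖f‖ := by
        induction n with
        | zero => exact fun f => rfl
        | succ n ih =>
          intro f
          rw [pow_succ']
          exact (hiso _).trans (ih f)
      have h1 : IsClosed ((opA10 A ^ n).range : Set (defectKer A)) :=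
        (AddMonoidHomClass.isometry_of_norm (opA10 A ^ n) hn).isClosedEmbedding.isClosed_range
      exact (defectOp A).isClosed_ker.isClosedEmbedding_subtypeVal.isClosedMap _ h1
    -- The unitary part of the isometry A ↾ ker D_A; complete non-unitarity will force it to vanish.
    let K : Submodule ℂ H := ⨅ n : ℕ, (opA10 A ^ n).range.map (defectKer A).subtype
    have hmem : ∀ f : H, f ∈ K ↔ ∀ n : ℕ, ∃ g, ((opA10 A ^ n) g : H) = f := by
      intro f
      simp only [K, Submodule.mem_iInf]
      refine forall_congr' fun n => ⟨?_, ?_⟩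
      · rintro ⟨_, ⟨g, rfl⟩, rfl⟩
        exact ⟨g, rfl⟩
      · rintro ⟨g, rfl⟩
        exact ⟨_, ⟨g, rfl⟩, rfl⟩
    have hker : ∀ f ∈ K, f ∈ defectKer A := fun f hf => by
      obtain ⟨g, rfl⟩ := (hmem f).mp hf 0
      exact Subtype.coe_prop _
    have hinv : ∀ f ∈ K, A f ∈ K := fun f hf => by
      rw [hmem]
      intro n
      obtain ⟨g, rfl⟩ := (hmem f).mp hf n
      refine ⟨opA10 A g, ?_⟩
      rw [← hmap]
      change (((opA10 A ^ n) * opA10 A) g : H) = ((opA10 A * (opA10 A ^ n)) g : H)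
      rw [← pow_succ, ← pow_succ']
    have hadj : ∀ f ∈ K, A.adjoint f ∈ K ∧ A (A.adjoint f) = f := fun f hf => by
      have h1 : ∀ n : ℕ, ∃ g, ((opA10 A ^ n) g : H) = A.adjoint f ∧
          A ((opA10 A ^ n) g) = f := fun n => by
        -- A* removes one power of A, so membership of A*f at level n needs membership of f at level
        -- n + 1.
        obtain ⟨g, rfl⟩ := (hmem f).mp hf (n + 1)
        refine ⟨g, ?_⟩
        have h2 : ((opA10 A ^ (n + 1)) g : H) = A ((opA10 A ^ n) g) := by
          rw [pow_succ', ← hmap]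
          rfl
        rw [h2, (mem_defectKer_iff hA _).mp (Subtype.coe_prop _)]
        exact ⟨rfl, rfl⟩
      refine ⟨(hmem _).mpr fun n => (h1 n).imp fun _ => And.left, ?_⟩
      obtain ⟨g, hg, hg'⟩ := h1 0
      rw [← hg, hg']
    have hbot : K = ⊥ := by
      refine hcnu K ?_ hinv (fun f hf => (hadj f hf).1)
        (fun f hf => norm_map_of_mem_defectKer hA (hker f hf)) fun g hg => ⟨_, hadj g hg⟩
      simp only [K, Submodule.coe_iInf]
      exact isClosed_iInter hpow
    refine isUnilateralShift_of_isometry hiso fun f hf => Subtype.ext ?_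
    refine (Submodule.eq_bot_iff K).mp hbot _ ((hmem _).mpr fun n => ?_)
    exact (hf n).imp fun g hg => congrArg _ hg

theorem isUnilateralShift_opA01_iff {A : H →L[ℂ] H} (hA : ‖A‖ ≤ 1) :
    IsUnilateralShift (opA01 A) ↔ IsUnilateralShift (opA10 A) :=
  ⟨(unitarilyEquivalent_opA10_opA01 hA).symm.isUnilateralShift,
    (unitarilyEquivalent_opA10_opA01 hA).isUnilateralShift⟩

theorem adjoint_opA01 (A : H →L[ℂ] H) : (opA01 A).adjoint = opA10 A.adjoint :=
  adjoint_between _ _ _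

theorem adjoint_opA10_adjoint (A : H →L[ℂ] H) : (opA10 A.adjoint).adjoint = opA01 A := by
  rw [← adjoint_opA01, adjoint_adjoint]

/-- The adjoint of A_{0,1} is the operator A_{1,0} formed from A*, so the shift criterion for A*
applies. -/
theorem isCoShift_opA01_iff {A : H →L[ℂ] H} (hA : ‖A‖ ≤ 1) (hcnu : IsCompletelyNonUnitary A) :
    IsCoShift (opA01 A) ↔ defectSpace A.adjoint ≤ defectSpace A := by
  rw [IsCoShift, adjoint_opA01, isUnilateralShift_opA10_iff (norm_adjoint_le_one hA)
    (hcnu.adjoint hA), adjoint_adjoint]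

theorem isCoShift_opA10_iff {A : H →L[ℂ] H} (hA : ‖A‖ ≤ 1) (hcnu : IsCompletelyNonUnitary A) :
    IsCoShift (opA10 A) ↔ defectSpace A.adjoint ≤ defectSpace A := by
  have h := isUnilateralShift_opA01_iff (norm_adjoint_le_one hA)
  rw [isUnilateralShift_opA10_iff (norm_adjoint_le_one hA) (hcnu.adjoint hA), ← adjoint_opA10_adjoint,
    adjoint_adjoint] at h
  exact h

end Shift

end CNU

/-! ### Assembly of the equivalences and of Z = Φ_V. -/

namespace CNU

variable {H : Type*} [NormedAddCommGroup H] [InnerProductSpace ℂ H] [CompleteSpace H]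
  {K L : Submodule ℂ H} [CompleteSpace K] [CompleteSpace L] {A : H →L[ℂ] H} {Θ : ℂ → K →L[ℂ] L}
  {Z : ℂ → defectSpace (Θ 0) →L[ℂ] defectSpace (Θ 0).adjoint}

theorem IsCharFunOf.tfae_isUnilateralShift (hA : ‖A‖ ≤ 1) (hcnu : IsCompletelyNonUnitary A)
    (h : IsCharFunOf A Θ) (hZ : IsMobiusParameter Θ Z) :
    List.TFAE [IsUnilateralShift (opA10 A), IsUnilateralShift (opA01 A),
      defectSpace A ≤ defectSpace A.adjoint,
      ∀ z ∈ Metric.ball (0 : ℂ) 1, ∀ f : defectSpace (Θ 0),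
        ((Z z f : L) : H) = z • ((f : K) : H)] := by
  have h34 := h.le_iff_mobiusParameter_eq_smul hA hZ
  have hle : defectSpace A ≤ defectSpace A.adjoint ↔ K ≤ L := by rw [h.dom_eq, h.cod_eq]
  tfae_have 1 ↔ 3 := isUnilateralShift_opA10_iff hA hcnu
  tfae_have 2 ↔ 1 := isUnilateralShift_opA01_iff hA
  tfae_have 3 ↔ 4 := hle.trans h34
  tfae_finish

theorem IsCharFunOf.tfae_isCoShift (hA : ‖A‖ ≤ 1) (hcnu : IsCompletelyNonUnitary A)
    (h : IsCharFunOf A Θ) (hZ : IsMobiusParameter Θ Z) :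
    List.TFAE [IsCoShift (opA10 A), IsCoShift (opA01 A),
      defectSpace A.adjoint ≤ defectSpace A,
      ∀ z ∈ Metric.ball (0 : ℂ) 1, ∀ g : defectSpace (Θ 0).adjoint,
        (((Z (starRingEnd ℂ z)).adjoint g : K) : H) = z • ((g : L) : H)] := by
  have h34 := h.le_iff_adjoint_mobiusParameter_eq_smul hA hZ
  have hle : defectSpace A.adjoint ≤ defectSpace A ↔ L ≤ K := by rw [h.dom_eq, h.cod_eq]
  tfae_have 1 ↔ 3 := isCoShift_opA10_iff hA hcnu
  tfae_have 2 ↔ 3 := isCoShift_opA01_iff hA hcnu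
  tfae_have 3 ↔ 4 := hle.trans h34
  tfae_finish

/-- The two functions act between different types, so arguments and values are compared in H. -/
theorem IsCharFunOf.coe_mobiusParameter_eq_charFun (hA : ‖A‖ ≤ 1) (h : IsCharFunOf A Θ)
    (hZ : IsMobiusParameter Θ Z) :
    ∀ z ∈ Metric.ball (0 : ℂ) 1, ∀ (f : defectSpace (Θ 0)) (g : defectSpace (isometricPart A)),
      ((f : K) : H) = (g : H) → ((Z z f : L) : H) = (charFun (isometricPart A) z g : H) := by
  intro z hz f g hfg
  rw [h.coe_mobiusParameter hA hZ hz, coe_charFun_isometricPart hA, hfg]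
  simp only [h.cod_eq]

end CNU

theorem mainTheorem4 {H : Type*} [NormedAddCommGroup H] [InnerProductSpace ℂ H] [CompleteSpace H]
    (A : H →L[ℂ] H) (hA : ‖A‖ ≤ 1) (hcnu : CNU.IsCompletelyNonUnitary A) :
    -- the operator `A P_{ker D_A}` is a partial isometry, and `A_{1,0} ≅ A_{0,1}`
    CNU.IsPartialIsometry (CNU.isometricPart A) ∧
    CNU.UnitarilyEquivalent (CNU.opA10 A) (CNU.opA01 A) ∧
    -- the subspaces `𝔇_{Φ(0)} ⊂ 𝔇_A` and `𝔇_{Φ(0)*} ⊂ 𝔇_{A*}`, seen in `H`, between which `Z` acts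
    -- are `𝔇_A` and `𝔇_{A*}`, and are also the defect spaces of `A P_{ker D_A}`
    (CNU.defectSpace (CNU.charFun A 0)).map (CNU.defectSpace A).subtype = CNU.defectSpace A ∧
    (CNU.defectSpace (CNU.charFun A 0).adjoint).map (CNU.defectSpace A.adjoint).subtype =
      CNU.defectSpace A.adjoint ∧
    CNU.defectSpace (CNU.isometricPart A) = CNU.defectSpace A ∧
    CNU.defectSpace (CNU.isometricPart A).adjoint = CNU.defectSpace A.adjoint ∧
    -- the Möbius parameter `Z` of the characteristic function of `A` exists
    (∃ Z, CNU.IsMobiusParameter (CNU.charFun A) Z) ∧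
    ∀ Z, CNU.IsMobiusParameter (CNU.charFun A) Z →
      -- `Z` is the characteristic function of `A P_{ker D_A}`
      (∀ z ∈ Metric.ball (0 : ℂ) 1, ∀ (f : CNU.defectSpace (CNU.charFun A 0))
        (g : CNU.defectSpace (CNU.isometricPart A)), ((f : CNU.defectSpace A) : H) = (g : H) →
        ((Z z f : CNU.defectSpace A.adjoint) : H) = (CNU.charFun (CNU.isometricPart A) z g : H)) ∧
      -- the equivalences for unilateral shifts
      List.TFAE
        [CNU.IsUnilateralShift (CNU.opA10 A),
         CNU.IsUnilateralShift (CNU.opA01 A),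
         CNU.defectSpace A ≤ CNU.defectSpace A.adjoint,
         ∀ z ∈ Metric.ball (0 : ℂ) 1, ∀ f : CNU.defectSpace (CNU.charFun A 0),
           ((Z z f : CNU.defectSpace A.adjoint) : H) = z • ((f : CNU.defectSpace A) : H)] ∧
      -- the equivalences for co-shifts
      List.TFAE
        [CNU.IsCoShift (CNU.opA10 A),
         CNU.IsCoShift (CNU.opA01 A),
         CNU.defectSpace A.adjoint ≤ CNU.defectSpace A,
         ∀ z ∈ Metric.ball (0 : ℂ) 1, ∀ g : CNU.defectSpace (CNU.charFun A 0).adjoint,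
           (((Z (starRingEnd ℂ z)).adjoint g : CNU.defectSpace A) : H) =
             z • ((g : CNU.defectSpace A.adjoint) : H)] := by
  have h := CNU.isCharFunOf_charFun hA
  refine ⟨CNU.isPartialIsometry_isometricPart hA, CNU.unitarilyEquivalent_opA10_opA01 hA,
    h.map_defectSpace_zero hA, h.map_defectSpace_adjoint_zero hA,
    CNU.defectSpace_isometricPart hA, ?_, ⟨_, h.isMobiusParameter hA⟩,
    fun Z hZ => ⟨h.coe_mobiusParameter_eq_charFun hA hZ, h.tfae_isUnilateralShift hA hcnu hZ,
      h.tfae_isCoShift hA hcnu hZ⟩⟩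
  rw [CNU.adjoint_isometricPart hA, CNU.defectSpace_isometricPart (CNU.norm_adjoint_le_one hA)]
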